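/- **Corollary 3 (Linear-over-log lower bound).** The $n$-qubit Clifford group is the group of unitaries on $(\mathbb C^2)^{\otimes n}$ generated by the gates $S=\begin{pmatrix}1&0\\0&i\end{pmatrix}$ and $H=\frac1{\sqrt2}\begin{pmatrix}1&1\\1&-1\end{pmatrix}$ on any qubit and $CX:|a,b\rangle\mapsto|a,a\oplus b\rangle$ on any ordered pair of distinct qubits; the $n$-qubit stabilizer states are the vectors $C|0^n\rangle$ with $C$ in this group. The stabilizer rank $\chi(|\psi\rangle)$ is the smallest $k$ such that $|\psi\rangle=\sum_{i=1}^k\alpha_i|s_i\rangle$ with $\alpha_i\in\mathbb C$ and stabilizer states $|s_i\rangle$. Let $|H\rangle=\cos(\pi/8)|0\rangle+\sin(\pi/8)|1\rangle$ and $F(|\psi\rangle,|\phi\rangle)=|\langle\psi|\phi\rangle|^2$. For every constant $c>\cos^2(\pi/8)$ there is a constant $K>0$, depending only on $c$, such that for every $n\ge 2$ and every $n$-qubit pure state (unit vector) $|\psi\rangle$ with $F(|\psi\rangle,|H\rangle^{\otimes n})\ge c^n$, $$\chi(|\psi\rangle)\ \ge\ K\,\frac{n}{\log n};$$ that is, $\chi(|\psi\rangle)=\Omega(n/\log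 n)$. Since $\cos^2(\pi/8)<1$, values $c<1$ are allowed, so the bound holds even when the fidelity with $|H\rangle^{\otimes n}$ is exponentially small. -/

import Mathlib

open scoped Matrix

noncomputable section

/-- The Hilbert space `(ℂ²)^{⊗ n}` of `n` qubits; its orthonormal computational basis is indexed by
the bit strings `x : Fin n → Fin 2`. -/
abbrev QubitSpace (n : ℕ) : Type := EuclideanSpace ℂ (Fin n → Fin 2)

/-- The group of unitary operators on `n` qubits, as matrices in the computational basis. -/
abbrev QubitUnitary (n : ℕ) : Type := Matrix.unitaryGroup (Fin n → Fin 2) ℂ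

/-- The `n`-qubit operator that applies the `m`-qubit operator `A` to the (distinct, ordered) qubits
`f 0, …, f (m - 1)` and the identity to all the other qubits. -/
def applyOn {m n : ℕ} (f : Fin m ↪ Fin n) (A : Matrix (Fin m → Fin 2) (Fin m → Fin 2) ℂ) :
    Matrix (Fin n → Fin 2) (Fin n → Fin 2) ℂ :=
  open Classical in
  Matrix.of fun x y => if ∀ i, i ∉ Set.range f → x i = y i then A (x ∘ f) (y ∘ f) else 0

theorem applyOn_mul {m n : ℕ} (f : Fin m ↪ Fin n)
    (A B : Matrix (Fin m → Fin 2) (Fin m → Fin 2) ℂ) :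
    applyOn f A * applyOn f B = applyOn f (A * B) := by
  classical
  ext x y
  simp only [applyOn, Matrix.mul_apply, Matrix.of_apply]
  by_cases h : ∀ i, i ∉ Set.range f → x i = y i
  · rw [if_pos h]
    symm
    refine Finset.sum_of_injOn (fun w => Function.extend f w x) ?_ (by simp) ?_ ?_
    · intro w _ w' _ hw
      have := congrArg (fun g : Fin n → Fin 2 => g ∘ f) hw
      simpa [Function.extend_comp f.injective] using this
    · intro z _ hz
      rw [if_neg, zero_mul]
      intro hxz
      apply hz
      refine ⟨z ∘ f, by simp, ?_⟩
      funext i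
      by_cases hi : i ∈ Set.range f
      · obtain ⟨j, rfl⟩ := hi
        simp [f.injective.extend_apply]
      · have : ¬ ∃ a, f a = i := hi
        simp [Function.extend_apply' _ _ _ this, hxz i hi]
    · intro w _
      have e : ∀ i, i ∉ Set.range f → Function.extend f w x i = x i := fun i hi =>
        Function.extend_apply' _ _ _ hi
      rw [if_pos (fun i hi => (e i hi).symm), if_pos (fun i hi => (e i hi).trans (h i hi)),
        Function.extend_comp f.injective]
  · rw [if_neg h]
    refine Finset.sum_eq_zero fun z _ => ?_
    by_cases h1 : ∀ i, i ∉ Set.range f → x i = z i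
    · have h2 : ¬ ∀ i, i ∉ Set.range f → z i = y i := fun h2 =>
        h fun i hi => (h1 i hi).trans (h2 i hi)
      rw [if_neg h2, mul_zero]
    · rw [if_neg h1, zero_mul]

theorem applyOn_one {m n : ℕ} (f : Fin m ↪ Fin n) : applyOn f 1 = 1 := by
  classical
  ext x y
  simp only [applyOn, Matrix.of_apply, Matrix.one_apply]
  by_cases hxy : x = y
  · simp [hxy]
  · rw [if_neg hxy]
    split_ifs with h1 h2
    · refine absurd (funext fun i => ?_) hxy
      by_cases hi : i ∈ Set.range f
      · obtain ⟨j, rfl⟩ := hi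
        exact congrFun h2 j
      · exact h1 i hi
    · rfl
    · rfl

theorem applyOn_conjTranspose {m n : ℕ} (f : Fin m ↪ Fin n)
    (A : Matrix (Fin m → Fin 2) (Fin m → Fin 2) ℂ) : (applyOn f A)ᴴ = applyOn f Aᴴ := by
  classical
  ext x y
  simp only [applyOn, Matrix.of_apply, Matrix.conjTranspose_apply, apply_ite star, star_zero]
  simp only [eq_comm]

/-- `applyOn` for unitary operators. -/
def applyUnitaryOn {m n : ℕ} (f : Fin m ↪ Fin n) (U : QubitUnitary m) : QubitUnitary n :=
  ⟨applyOn f U.1, by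
    rw [Matrix.mem_unitaryGroup_iff, Matrix.star_eq_conjTranspose, applyOn_conjTranspose,
      applyOn_mul, ← Matrix.star_eq_conjTranspose, Matrix.mem_unitaryGroup_iff.mp U.2,
      applyOn_one]⟩

/-- A `2 × 2` matrix, as an operator on one qubit (indexed by bit strings of length one). -/
def oneQubit (A : Matrix (Fin 2) (Fin 2) ℂ) : Matrix (Fin 1 → Fin 2) (Fin 1 → Fin 2) ℂ :=
  Matrix.of fun x y => A (x 0) (y 0)

theorem oneQubit_mem {A : Matrix (Fin 2) (Fin 2) ℂ} (hA : A * Aᴴ = 1) :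
    oneQubit A ∈ Matrix.unitaryGroup (Fin 1 → Fin 2) ℂ := by
  rw [Matrix.mem_unitaryGroup_iff]
  ext x y
  have h := congrFun (congrFun hA (x 0)) (y 0)
  rw [Matrix.mul_apply] at h ⊢
  rw [← (Equiv.funUnique (Fin 1) (Fin 2)).symm.sum_comp]
  have e : x = y ↔ x 0 = y 0 :=
    ⟨fun h => by rw [h], fun h => funext fun i => by rw [Subsingleton.elim i 0, h]⟩
  simpa [oneQubit, Matrix.star_eq_conjTranspose, Matrix.one_apply, e] using h

/-- The phase gate `S`. -/
def gateS : QubitUnitary 1 :=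
  ⟨oneQubit !![1, 0; 0, Complex.I], oneQubit_mem (by
    ext i j; fin_cases i <;> fin_cases j <;> simp [Matrix.mul_apply])⟩

/-- The Hadamard gate `H`. -/
def gateH : QubitUnitary 1 :=
  ⟨oneQubit (((1 / √2 : ℝ) : ℂ) • !![1, 1; 1, -1]), oneQubit_mem (by
    have h : ((√2 : ℝ) : ℂ)⁻¹ * ((√2 : ℝ) : ℂ)⁻¹ = 1 / 2 := by
      rw [← mul_inv, ← Complex.ofReal_mul, Real.mul_self_sqrt (by norm_num)]; norm_num
    ext i j; fin_cases i <;> fin_cases j <;> simp [Matrix.mul_apply, h] <;> norm_num)⟩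

/-- The controlled-NOT gate `CX`, `|a, b⟩ ↦ |a, a + b⟩`: qubit `0` is the control, qubit `1` the
target. -/
def gateCX : QubitUnitary 2 :=
  ⟨Matrix.of fun x y => if x = ![y 0, y 0 + y 1] then 1 else 0, by
    rw [Matrix.mem_unitaryGroup_iff]
    ext x y
    have e : ∀ x z : Fin 2 → Fin 2, x = ![z 0, z 0 + z 1] ↔ z = ![x 0, x 0 + x 1] := by decide
    have e' : ∀ x y : Fin 2 → Fin 2,
        (![x 0, x 0 + x 1] : Fin 2 → Fin 2) = ![y 0, y 0 + y 1] ↔ x = y := by decide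
    rw [Matrix.mul_apply, Finset.sum_eq_single ![x 0, x 0 + x 1]]
    · have h1 := (e x ![x 0, x 0 + x 1]).mpr rfl
      have h2 : (y = ![(![x 0, x 0 + x 1] : Fin 2 → Fin 2) 0,
          (![x 0, x 0 + x 1] : Fin 2 → Fin 2) 0 + (![x 0, x 0 + x 1] : Fin 2 → Fin 2) 1]) ↔ x = y :=
        (e y _).trans (e' x y)
      rw [Matrix.star_apply, Matrix.of_apply, Matrix.of_apply, if_pos h1, one_mul, Matrix.one_apply]
      by_cases h : x = y
      · rw [if_pos (h2.mpr h), if_pos h, star_one]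
      · rw [if_neg (fun h' => h (h2.mp h')), if_neg h, star_zero]
    · intro z _ hz
      rw [Matrix.of_apply, if_neg (fun h => hz ((e x z).mp h)), zero_mul]
    · simp⟩

/-- The `n`-qubit Clifford group: the group generated by the gates `S` and `H` on any qubit and `CX`
on any ordered pair of distinct qubits. -/
def cliffordGroup (n : ℕ) : Subgroup (QubitUnitary n) :=
  Subgroup.closure
    ({U | ∃ f : Fin 1 ↪ Fin n, U = applyUnitaryOn f gateS} ∪
      {U | ∃ f : Fin 1 ↪ Fin n, U = applyUnitaryOn f gateH} ∪
      {U | ∃ f : Fin 2 ↪ Fin n, U = applyUnitaryOn f gateCX})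

/-- The action of a unitary operator on a state vector. -/
def QubitUnitary.act {n : ℕ} (U : QubitUnitary n) (ψ : QubitSpace n) : QubitSpace n :=
  WithLp.toLp 2 (U.1 *ᵥ ψ.ofLp)

/-- The computational basis state `|0ⁿ⟩`. -/
def ketZero (n : ℕ) : QubitSpace n := EuclideanSpace.single (fun _ => 0) 1

/-- The set of `n`-qubit stabilizer states `C |0ⁿ⟩`, `C` in the Clifford group. -/
def stabilizerStates (n : ℕ) : Set (QubitSpace n) :=
  {s | ∃ C ∈ cliffordGroup n, s = QubitUnitary.act C (ketZero n)}

/-- The exact stabilizer rank `χ(ψ)`: the smallest `k` such that `ψ` is a complex linear combination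
of `k` stabilizer states. -/
def stabilizerRank {n : ℕ} (ψ : QubitSpace n) : ℕ :=
  sInf {k : ℕ | ∃ (α : Fin k → ℂ) (s : Fin k → QubitSpace n),
    (∀ i, s i ∈ stabilizerStates n) ∧ ψ = ∑ i, α i • s i}

/-- The single-qubit magic state `|H⟩ = cos(π/8) |0⟩ + sin(π/8) |1⟩`. -/
def ketH : EuclideanSpace ℂ (Fin 2) :=
  !₂[(Real.cos (Real.pi / 8) : ℂ), (Real.sin (Real.pi / 8) : ℂ)]

/-- The tensor power `φ^{⊗ n}` of a single-qubit state `φ`. -/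
def tensorPower (φ : EuclideanSpace ℂ (Fin 2)) (n : ℕ) : QubitSpace n :=
  WithLp.toLp 2 fun x => ∏ i, φ (x i)

/-- The fidelity `|⟨ψ|φ⟩|²` of two pure states. -/
def fidelity {n : ℕ} (ψ φ : QubitSpace n) : ℝ := ‖inner ℂ ψ φ‖ ^ 2

end

/-! Measure a nonzero vector by the number of Pauli operators having it as an eigenvector. Their
labels commute and are closed under addition, so there are at most `2 ^ n` of them, and a stabilizer
state has all `2 ^ n`. Suppose `v` has at least `2 ^ n / D`. Two facts drive the proof.

Small overlap (`norm_inner_tensorPower_sq_le`): projecting onto the joint eigenspace of `v` bounds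
its overlap with `|H⟩^{⊗n}` by a sum of Pauli expectations over an isotropic set. That sum is at
most `(1 + 1/√2)^n = (2 cos²(π/8))^n`, so the squared overlap is at most `‖v‖² D cos²(π/8)^n`.

Merging (`two_pow_le_card_eigenLabels_add`): if `u`, `v` have defects `D`, `E` and normalized
squared overlap above `1/Q`, then `u + v` has defect at most `D E Q`.

In a sum of `k` stabilizer terms, keep merging pairs with normalized squared overlap above
`1/(4k²)`. Fewer than `k` merges occur, each costing a factor `4k²`. The remaining terms are nearly
orthogonal, so they cannot cancel, and Cauchy–Schwarz gives fidelity at most `2k (4k²)^k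
cos²(π/8)^n`. Comparing logarithms with `c^n` gives the bound. -/

/-! ### Pauli labels, commutation signs and isotropic sets. -/

/-- Labels of the one-qubit Pauli operators: `(x, z)` stands for `X ^ x * Z ^ z`. -/
abbrev PauliLabel : Type := Fin 2 × Fin 2

/-- The one-qubit sign of commutation: `-1` if the two Pauli operators anticommute. -/
def commSign₁ (p q : PauliLabel) : ℤ := if p.1 * q.2 + p.2 * q.1 = 0 then 1 else -1

/-- The sign of commutation of two Pauli operators. -/
def commSign {n : ℕ} (p q : Fin n → PauliLabel) : ℤ := ∏ i, commSign₁ (p i) (q i)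

theorem commSign_add_left {n : ℕ} (p p' q : Fin n → PauliLabel) :
    commSign (p + p') q = commSign p q * commSign p' q := by
  have h : ∀ p p' q, commSign₁ (p + p') q = commSign₁ p q * commSign₁ p' q := by decide
  simp [commSign, h, Finset.prod_mul_distrib]

theorem commSign_add_right {n : ℕ} (p q q' : Fin n → PauliLabel) :
    commSign p (q + q') = commSign p q * commSign p q' := by
  have h : ∀ p q q', commSign₁ p (q + q') = commSign₁ p q * commSign₁ p q' := by decide
  simp [commSign, h, Finset.prod_mul_distrib]

theorem commSign_comm {n : ℕ} (p q : Fin n → PauliLabel) : commSign p q = commSign q p := by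
  have h : ∀ p q, commSign₁ p q = commSign₁ q p := by decide
  exact Finset.prod_congr rfl fun i _ => h _ _

theorem commSign_zero_left {n : ℕ} (q : Fin n → PauliLabel) : commSign 0 q = 1 := by
  have h : ∀ q, commSign₁ 0 q = 1 := by decide
  simp [commSign, h]

theorem commSign_eq_one_or {n : ℕ} (p q : Fin n → PauliLabel) :
    commSign p q = 1 ∨ commSign p q = -1 := by
  have h : ∀ p q, commSign₁ p q * commSign₁ p q = 1 := by decide
  rw [← sq_eq_one_iff, sq, commSign, ← Finset.prod_mul_distrib]
  simp [h]

theorem commSign_cons {n : ℕ} (x y : PauliLabel) (p q : Fin n → PauliLabel) :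
    commSign (Fin.cons x p : Fin (n + 1) → PauliLabel) (Fin.cons y q) =
      commSign₁ x y * commSign p q := by
  simp [commSign, Fin.prod_univ_succ]

theorem pauliLabel_add_self (x : PauliLabel) : x + x = 0 := by
  revert x; decide

theorem pauliLabels_add_self {n : ℕ} (p : Fin n → PauliLabel) : p + p = 0 :=
  funext fun i => pauliLabel_add_self (p i)

theorem pauliLabels_add_add_cancel {n : ℕ} (p q : Fin n → PauliLabel) : p + (p + q) = q := by
  rw [← add_assoc, pauliLabels_add_self, zero_add]

/-- A set of labels closed under multiplication of Pauli operators, whose elements commute. -/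
structure Isotropic {n : ℕ} (L : Finset (Fin n → PauliLabel)) : Prop where
  add_mem : ∀ p ∈ L, ∀ q ∈ L, p + q ∈ L
  comm : ∀ p ∈ L, ∀ q ∈ L, commSign p q = 1

/-- The elements of `L` with first label `x`, with that label removed. -/
def labelSection {n : ℕ} (L : Finset (Fin (n + 1) → PauliLabel)) (x : PauliLabel) :
    Finset (Fin n → PauliLabel) :=
  {p | (Fin.cons x p : Fin (n + 1) → PauliLabel) ∈ L}

theorem mem_labelSection {n : ℕ} {L : Finset (Fin (n + 1) → PauliLabel)} {x : PauliLabel}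
    {p : Fin n → PauliLabel} :
    p ∈ labelSection L x ↔ (Fin.cons x p : Fin (n + 1) → PauliLabel) ∈ L := by
  simp [labelSection]

theorem cons_add_cons {n : ℕ} (x y : PauliLabel) (p q : Fin n → PauliLabel) :
    (Fin.cons x p + Fin.cons y q : Fin (n + 1) → PauliLabel) = Fin.cons (x + y) (p + q) := by
  funext i
  refine Fin.cases ?_ (fun j => ?_) i <;> simp

theorem sum_prod_labelSection {n : ℕ} (w : PauliLabel → ℝ)
    (L : Finset (Fin (n + 1) → PauliLabel)) :
    ∑ p ∈ L, ∏ i, w (p i) = ∑ x, w x * ∑ p ∈ labelSection L x, ∏ i, w (p i) := by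
  classical
  rw [show ∑ p ∈ L, ∏ i, w (p i) = ∑ p, if p ∈ L then ∏ i, w (p i) else 0 by simp,
    ← (Fin.consEquiv fun _ => PauliLabel).sum_comp, Fintype.sum_prod_type]
  refine Finset.sum_congr rfl fun x _ => ?_
  rw [labelSection, Finset.sum_filter, Finset.mul_sum]
  refine Finset.sum_congr rfl fun p _ => ?_
  simp [Fin.consEquiv, Fin.prod_univ_succ]

/-- The first labels involved are only `0` and `x`, which commute and are closed under addition, so
the tails inherit both properties. This feeds the inductions on `n`. -/
theorem Isotropic.labelSection_union {n : ℕ} {L : Finset (Fin (n + 1) → PauliLabel)}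
    (hL : Isotropic L) (x : PauliLabel) : Isotropic (labelSection L 0 ∪ labelSection L x) := by
  have h1 : ∀ x, commSign₁ 0 x = 1 := by decide
  have h2 : ∀ x, commSign₁ x 0 = 1 := by decide
  have h3 : ∀ x, commSign₁ x x = 1 := by decide
  constructor
  · intro p hp q hq
    simp only [Finset.mem_union, mem_labelSection] at hp hq ⊢
    rcases hp with hp | hp <;> rcases hq with hq | hq <;> have := hL.add_mem _ hp _ hq <;>
      rw [cons_add_cons] at this <;> simp_all [pauliLabel_add_self]
  · intro p hp q hq
    simp only [Finset.mem_union, mem_labelSection] at hp hq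
    rcases hp with hp | hp <;> rcases hq with hq | hq <;> have := hL.comm _ hp _ hq <;>
      rw [commSign_cons] at this <;> simpa only [h1, h2, h3, one_mul] using this

theorem Isotropic.labelSection_disjoint {n : ℕ} {L : Finset (Fin (n + 1) → PauliLabel)}
    (hL : Isotropic L) {x : PauliLabel}
    (hx : (Fin.cons x 0 : Fin (n + 1) → PauliLabel) ∉ L) :
    Disjoint (labelSection L 0) (labelSection L x) := by
  rw [Finset.disjoint_left]
  intro p hp hq
  rw [mem_labelSection] at hp hq
  have := hL.add_mem _ hp _ hq
  rw [cons_add_cons, pauliLabels_add_self, zero_add] at this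
  exact hx this

theorem Isotropic.labelSection_eq_empty {n : ℕ} {L : Finset (Fin (n + 1) → PauliLabel)}
    (hL : Isotropic L) {x y : PauliLabel}
    (hx : (Fin.cons x 0 : Fin (n + 1) → PauliLabel) ∈ L) (hxy : commSign₁ x y = -1) :
    labelSection L y = ∅ := by
  rw [Finset.eq_empty_iff_forall_notMem]
  intro p hp
  rw [mem_labelSection] at hp
  have := hL.comm _ hx _ hp
  rw [commSign_cons, commSign_zero_left, hxy] at this
  norm_num at this

/-- Translation by any one element of section `x` embeds that section in section `0`. -/
theorem Isotropic.card_labelSection_le {n : ℕ} {L : Finset (Fin (n + 1) → PauliLabel)}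
    (hL : Isotropic L) (x : PauliLabel) :
    (labelSection L x).card ≤ (labelSection L 0).card := by
  rcases (labelSection L x).eq_empty_or_nonempty with h | ⟨q, hq⟩
  · simp [h]
  · refine Finset.card_le_card_of_injOn (fun p => q + p) (fun p hp => ?_)
      (fun p _ p' _ h => add_left_cancel h)
    rw [Finset.mem_coe, mem_labelSection] at *
    have := hL.add_mem _ hq _ hp
    rwa [cons_add_cons, pauliLabel_add_self] at this

/-! ### Bounds on isotropic sets. -/

/-- The modulus of the expectation of a Pauli operator in the state `|H⟩`. -/
noncomputable def magicWeight (x : PauliLabel) : ℝ := if x = 0 then 1 else if x = (1, 1) then 0 else 1 / √2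

theorem magicWeight_nonneg (x : PauliLabel) : 0 ≤ magicWeight x := by
  unfold magicWeight; split_ifs <;> positivity

theorem sum_pauliLabel (f : PauliLabel → ℝ) :
    ∑ x, f x = f 0 + f (1, 0) + f (0, 1) + f (1, 1) := by
  rw [Fintype.sum_prod_type]
  simp only [Fin.sum_univ_two]
  have : (0 : PauliLabel) = (0, 0) := rfl
  rw [this]; ring

theorem Isotropic.sum_magicWeight_le {n : ℕ} {L : Finset (Fin n → PauliLabel)}
    (hL : Isotropic L) : ∑ p ∈ L, ∏ i, magicWeight (p i) ≤ (1 + 1 / √2) ^ n := by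
  induction n with
  | zero =>
    simp only [Finset.univ_eq_empty, Finset.prod_empty, pow_zero, Finset.sum_const, nsmul_eq_mul,
      mul_one]
    exact_mod_cast (Finset.card_le_univ L).trans (by simp)
  | succ n ih =>
    rw [sum_prod_labelSection, sum_pauliLabel]
    set f : PauliLabel → ℝ := fun x => ∑ p ∈ labelSection L x, ∏ i, magicWeight (p i) with hf
    set M : ℝ := (1 + 1 / √2) ^ n
    have hnn : ∀ x, 0 ≤ f x := fun x =>
      Finset.sum_nonneg fun p _ => Finset.prod_nonneg fun i _ => magicWeight_nonneg _
    have hu : ∀ x, ∑ p ∈ labelSection L 0 ∪ labelSection L x, ∏ i, magicWeight (p i) ≤ M :=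
      fun x => ih (hL.labelSection_union x)
    have hM : ∀ x, f x ≤ M := fun x => (Finset.sum_le_sum_of_subset_of_nonneg
      Finset.subset_union_right fun p _ _ => Finset.prod_nonneg fun i _ =>
        magicWeight_nonneg _).trans (hu x)
    have hd : ∀ x, (Fin.cons x 0 : Fin (n + 1) → PauliLabel) ∉ L → f 0 + f x ≤ M := by
      intro x hx
      have := hu x
      rwa [Finset.sum_union (hL.labelSection_disjoint hx)] at this
    have he : ∀ x y, (Fin.cons x 0 : Fin (n + 1) → PauliLabel) ∈ L → commSign₁ x y = -1 →
        f y = 0 := fun x y hx hxy => by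
      simp only [hf, hL.labelSection_eq_empty hx hxy, Finset.sum_empty]
    have w0 : magicWeight 0 = 1 := by simp [magicWeight]
    have w1 : magicWeight (1, 0) = 1 / √2 := by simp [magicWeight]
    have w2 : magicWeight (0, 1) = 1 / √2 := by simp [magicWeight]
    have w3 : magicWeight (1, 1) = 0 := by simp [magicWeight]
    change magicWeight 0 * f 0 + magicWeight (1, 0) * f (1, 0) + magicWeight (0, 1) * f (0, 1) +
      magicWeight (1, 1) * f (1, 1) ≤ _
    rw [w0, w1, w2, w3, pow_succ]
    change _ ≤ M * _
    have hr : (1 / √2) ^ 2 = 1 / 2 := by rw [div_pow, Real.sq_sqrt (by norm_num)]; norm_num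
    have hr0 : 0 ≤ 1 / √2 := by positivity
    generalize 1 / √2 = r at *
    have hr1 : r ≤ 1 := by nlinarith
    have hr2 : 1 / 2 ≤ r := by nlinarith
    have h0 := hM 0
    have h00 := hnn 0
    -- If `L` contains `X` acting on the first qubit alone, section `Z` is empty and two terms
    -- bounded by `M` remain; likewise with `X` and `Z` exchanged. The section of label `(1, 1)` has
    -- weight zero.
    by_cases hX : (Fin.cons (1, 0) 0 : Fin (n + 1) → PauliLabel) ∈ L
    · rw [he _ (0, 1) hX (by decide)]
      nlinarith [hM (1, 0)]
    by_cases hZ : (Fin.cons (0, 1) 0 : Fin (n + 1) → PauliLabel) ∈ L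
    · rw [he _ (1, 0) hZ (by decide)]
      nlinarith [hM (0, 1)]
    -- Now `f 0 + f X ≤ M` and `f 0 + f Z ≤ M`, so the sum is at most `2 r M + (1 - 2 r) f 0`, which
    -- is at most `(1 + r) M` since `1/2 ≤ r ≤ 1`.
    have h1 := mul_le_mul_of_nonneg_left (hd _ hX) hr0
    have h2 := mul_le_mul_of_nonneg_left (hd _ hZ) hr0
    nlinarith

theorem Isotropic.card_le {n : ℕ} {L : Finset (Fin n → PauliLabel)}
    (hL : Isotropic L) : L.card ≤ 2 ^ n := by
  induction n with
  | zero => exact (Finset.card_le_univ L).trans (by simp)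
  | succ n ih =>
    have hs : L.card = (labelSection L 0).card + (labelSection L (1, 0)).card +
        (labelSection L (0, 1)).card + (labelSection L (1, 1)).card := by
      have := sum_prod_labelSection (fun _ => 1) L
      rw [sum_pauliLabel] at this
      simp only [Finset.prod_const_one, Finset.sum_const, nsmul_eq_mul, mul_one, one_mul] at this
      exact_mod_cast this
    have hu : ∀ x, (labelSection L 0 ∪ labelSection L x).card ≤ 2 ^ n :=
      fun x => ih (hL.labelSection_union x)
    have hM : ∀ x, (labelSection L x).card ≤ 2 ^ n := fun x =>
      (Finset.card_le_card Finset.subset_union_right).trans (hu x)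
    have hd : ∀ x, (Fin.cons x 0 : Fin (n + 1) → PauliLabel) ∉ L →
        (labelSection L 0).card + (labelSection L x).card ≤ 2 ^ n := by
      intro x hx
      have := hu x
      rwa [Finset.card_union_of_disjoint (hL.labelSection_disjoint hx)] at this
    have he : ∀ x y, (Fin.cons x 0 : Fin (n + 1) → PauliLabel) ∈ L → commSign₁ x y = -1 →
        (labelSection L y).card = 0 := fun x y hx hxy => by
      rw [hL.labelSection_eq_empty hx hxy, Finset.card_empty]
    have h0 := hM 0
    rw [hs, pow_succ]
    by_cases hX : (Fin.cons (1, 0) 0 : Fin (n + 1) → PauliLabel) ∈ L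
    · have := he _ (0, 1) hX (by decide)
      have := he _ (1, 1) hX (by decide)
      have := hM (1, 0)
      omega
    by_cases hZ : (Fin.cons (0, 1) 0 : Fin (n + 1) → PauliLabel) ∈ L
    · have := he _ (1, 0) hZ (by decide)
      have := he _ (1, 1) hZ (by decide)
      have := hM (0, 1)
      omega
    -- Section `(1, 1)` is no larger than section `0`, so the two disjointness bounds add up to
    -- cover all four sections.
    have := hd _ hX
    have := hd _ hZ
    have := hL.card_labelSection_le (1, 1)
    omega

/-! ### Tensor products and the Pauli operators. -/

/-- The `n`-qubit operator `A 0 ⊗ ⋯ ⊗ A (n - 1)`. -/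
def tensorMatrix {n : ℕ} (A : Fin n → Matrix (Fin 2) (Fin 2) ℂ) :
    Matrix (Fin n → Fin 2) (Fin n → Fin 2) ℂ :=
  Matrix.of fun x y => ∏ i, A i (x i) (y i)

theorem tensorMatrix_mul {n : ℕ} (A B : Fin n → Matrix (Fin 2) (Fin 2) ℂ) :
    tensorMatrix A * tensorMatrix B = tensorMatrix fun i => A i * B i := by
  ext x y
  simp only [tensorMatrix, Matrix.mul_apply, Matrix.of_apply, ← Finset.prod_mul_distrib]
  rw [Finset.prod_univ_sum, Fintype.piFinset_univ]

theorem tensorMatrix_smul {n : ℕ} (c : Fin n → ℂ) (A : Fin n → Matrix (Fin 2) (Fin 2) ℂ) :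
    (tensorMatrix fun i => c i • A i) = (∏ i, c i) • tensorMatrix A := by
  ext x y
  simp [tensorMatrix, Finset.prod_mul_distrib]

theorem tensorMatrix_conjTranspose {n : ℕ} (A : Fin n → Matrix (Fin 2) (Fin 2) ℂ) :
    (tensorMatrix A)ᴴ = tensorMatrix fun i => (A i)ᴴ := by
  ext x y
  simp [tensorMatrix]

theorem tensorMatrix_one {n : ℕ} : (tensorMatrix fun _ : Fin n => 1) = 1 := by
  ext x y
  simp only [tensorMatrix, Matrix.of_apply, Matrix.one_apply, Finset.prod_ite_zero]
  simp [funext_iff]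

theorem tensorMatrix_mulVec {n : ℕ} (A : Fin n → Matrix (Fin 2) (Fin 2) ℂ)
    (φ : Fin n → Fin 2 → ℂ) :
    (tensorMatrix A *ᵥ fun x => ∏ i, φ i (x i)) = fun x => ∏ i, (A i *ᵥ φ i) (x i) := by
  ext x
  simp only [tensorMatrix, Matrix.mulVec, dotProduct, Matrix.of_apply, ← Finset.prod_mul_distrib]
  rw [Finset.prod_univ_sum, Fintype.piFinset_univ]

theorem applyOn_oneQubit {n : ℕ} (f : Fin 1 ↪ Fin n) (B : Matrix (Fin 2) (Fin 2) ℂ) :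
    applyOn f (oneQubit B) = tensorMatrix fun i => if i = f 0 then B else 1 := by
  classical
  have hr : ∀ i, i ∉ Set.range f ↔ i ≠ f 0 := by
    intro i
    simp only [Set.mem_range, not_exists, ne_eq]
    exact ⟨fun h e => h 0 e.symm, fun h j e => h (by rw [← e, Subsingleton.elim j 0])⟩
  ext x y
  simp only [applyOn, tensorMatrix, Matrix.of_apply, hr, oneQubit, Function.comp_apply]
  rw [← Finset.mul_prod_erase _ _ (Finset.mem_univ (f 0)), if_pos rfl]
  by_cases h : ∀ i, i ≠ f 0 → x i = y i
  · rw [if_pos h, Finset.prod_eq_one, mul_one]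
    intro i hi
    rw [if_neg (Finset.ne_of_mem_erase hi), h i (Finset.ne_of_mem_erase hi), Matrix.one_apply_eq]
  · rw [if_neg h]
    push Not at h
    obtain ⟨i, hi, hxy⟩ := h
    rw [Finset.prod_eq_zero (Finset.mem_erase.mpr ⟨hi, Finset.mem_univ i⟩) ?_, mul_zero]
    rw [if_neg hi, Matrix.one_apply_ne hxy]

/-- The entries of the one-qubit Pauli operator `X ^ x * Z ^ z`. -/
def pauliEntry (p : PauliLabel) (a b : Fin 2) : ℤ :=
  if a = b + p.1 then (if p.2 * b = 0 then 1 else -1) else 0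

/-- The one-qubit Pauli operator `X ^ x * Z ^ z`. -/
def pauli₁ (p : PauliLabel) : Matrix (Fin 2) (Fin 2) ℂ := Matrix.of fun a b => (pauliEntry p a b : ℂ)

/-- The `n`-qubit Pauli operator with the given labels. -/
def pauli {n : ℕ} (p : Fin n → PauliLabel) : Matrix (Fin n → Fin 2) (Fin n → Fin 2) ℂ :=
  tensorMatrix fun i => pauli₁ (p i)

/-- The sign in the product of two one-qubit Pauli operators. -/
def mulSign₁ (p q : PauliLabel) : ℤ := if p.2 * q.1 = 0 then 1 else -1

/-- The sign in the product of two Pauli operators. -/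
def mulSign {n : ℕ} (p q : Fin n → PauliLabel) : ℤ := ∏ i, mulSign₁ (p i) (q i)

theorem mulSign_mul_self {n : ℕ} (p q : Fin n → PauliLabel) : mulSign p q * mulSign p q = 1 := by
  have h : ∀ p q, mulSign₁ p q * mulSign₁ p q = 1 := by decide
  simp [mulSign, ← Finset.prod_mul_distrib, h]

theorem norm_mulSign {n : ℕ} (p q : Fin n → PauliLabel) : ‖(mulSign p q : ℂ)‖ = 1 := by
  have h : (mulSign p q : ℂ) * mulSign p q = 1 := by exact_mod_cast mulSign_mul_self p q
  rw [← sq, sq_eq_one_iff] at h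
  rcases h with h | h <;> simp [h]

theorem mulSign_ne_zero {n : ℕ} (p q : Fin n → PauliLabel) : (mulSign p q : ℂ) ≠ 0 :=
  norm_ne_zero_iff.mp (by rw [norm_mulSign]; norm_num)

theorem mulSign_comm {n : ℕ} (p q : Fin n → PauliLabel) :
    mulSign p q = commSign p q * mulSign q p := by
  have h : ∀ p q, mulSign₁ p q = commSign₁ p q * mulSign₁ q p := by decide
  simp only [mulSign, commSign, ← Finset.prod_mul_distrib]
  exact Finset.prod_congr rfl fun i _ => h _ _

/-- Integer entries make this a finite check by `decide`; the cast to `ℂ` comes afterwards. -/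
theorem pauli₁_mul (p q : PauliLabel) : pauli₁ p * pauli₁ q = (mulSign₁ p q : ℂ) • pauli₁ (p + q) := by
  have h : ∀ p q a b, pauliEntry p a 0 * pauliEntry q 0 b + pauliEntry p a 1 * pauliEntry q 1 b =
    mulSign₁ p q * pauliEntry (p + q) a b := by decide
  ext a b
  simp only [pauli₁, Matrix.mul_apply, Matrix.of_apply, Matrix.smul_apply, Fin.sum_univ_two,
    smul_eq_mul]
  exact_mod_cast h p q a b

theorem pauli₁_conjTranspose (p : PauliLabel) : (pauli₁ p)ᴴ = (mulSign₁ p p : ℂ) • pauli₁ p := by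
  have h : ∀ p a b, pauliEntry p b a = mulSign₁ p p * pauliEntry p a b := by decide
  ext a b
  simp only [pauli₁, Matrix.conjTranspose_apply, Matrix.of_apply, Matrix.smul_apply, smul_eq_mul,
    h p a b]
  simp

theorem pauli_mul {n : ℕ} (p q : Fin n → PauliLabel) :
    pauli p * pauli q = (mulSign p q : ℂ) • pauli (p + q) := by
  simp only [pauli, tensorMatrix_mul, pauli₁_mul, tensorMatrix_smul, mulSign, Int.cast_prod,
    Pi.add_apply]

theorem pauli_conjTranspose {n : ℕ} (p : Fin n → PauliLabel) :
    (pauli p)ᴴ = (mulSign p p : ℂ) • pauli p := by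
  simp only [pauli, tensorMatrix_conjTranspose, pauli₁_conjTranspose, tensorMatrix_smul, mulSign,
    Int.cast_prod]

theorem pauli₁_zero : pauli₁ 0 = 1 := by
  have h : ∀ a b, pauliEntry 0 a b = if a = b then 1 else 0 := by decide
  ext a b
  simp [pauli₁, h, Matrix.one_apply]

theorem pauli_zero {n : ℕ} : pauli (0 : Fin n → PauliLabel) = 1 := by
  simp only [pauli, Pi.zero_apply, pauli₁_zero, tensorMatrix_one]

/-- The action of a Pauli operator on state vectors. -/
noncomputable def pauliOp {n : ℕ} (p : Fin n → PauliLabel) : QubitSpace n →ₗ[ℂ] QubitSpace n :=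
  Matrix.toEuclideanLin (pauli p)

theorem pauliOp_pauliOp {n : ℕ} (p q : Fin n → PauliLabel) (v : QubitSpace n) :
    pauliOp p (pauliOp q v) = (mulSign p q : ℂ) • pauliOp (p + q) v := by
  rw [pauliOp, pauliOp, ← LinearMap.comp_apply, ← Matrix.toLpLin_mul_same, pauli_mul, map_smul]
  rfl

theorem pauliOp_zero {n : ℕ} (v : QubitSpace n) : pauliOp 0 v = v := by
  rw [pauliOp, pauli_zero, Matrix.toLpLin_one, LinearMap.id_apply]

theorem pauliOp_comm {n : ℕ} (p q : Fin n → PauliLabel) (v : QubitSpace n) :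
    pauliOp p (pauliOp q v) = (commSign p q : ℂ) • pauliOp q (pauliOp p v) := by
  rw [pauliOp_pauliOp, pauliOp_pauliOp, smul_smul, mulSign_comm, add_comm]
  push_cast; rfl

theorem inner_pauliOp_left {n : ℕ} (p : Fin n → PauliLabel) (v w : QubitSpace n) :
    inner ℂ (pauliOp p v) w = (mulSign p p : ℂ) * inner ℂ v (pauliOp p w) := by
  rw [pauliOp, ← LinearMap.adjoint_inner_right, ← Matrix.toEuclideanLin_conjTranspose_eq_adjoint,
    pauli_conjTranspose, map_smul, LinearMap.smul_apply, inner_smul_right]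

theorem inner_pauliOp_pauliOp {n : ℕ} (p : Fin n → PauliLabel) (v w : QubitSpace n) :
    inner ℂ (pauliOp p v) (pauliOp p w) = inner ℂ v w := by
  rw [inner_pauliOp_left, pauliOp_pauliOp, pauliLabels_add_self, pauliOp_zero, inner_smul_right,
    ← mul_assoc]
  rw [show (mulSign p p : ℂ) * mulSign p p = 1 by exact_mod_cast mulSign_mul_self p p, one_mul]

theorem norm_inner_pauliOp_pauliOp {n : ℕ} (p q : Fin n → PauliLabel) (v : QubitSpace n) :
    ‖inner ℂ (pauliOp p v) (pauliOp q v)‖ = ‖inner ℂ v (pauliOp (p + q) v)‖ := by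
  rw [inner_pauliOp_left, pauliOp_pauliOp, inner_smul_right, norm_mul, norm_mul, norm_mulSign,
    norm_mulSign, one_mul, one_mul]

theorem norm_pauliOp {n : ℕ} (p : Fin n → PauliLabel) (v : QubitSpace n) :
    ‖pauliOp p v‖ = ‖v‖ := by
  rw [← sq_eq_sq₀ (norm_nonneg _) (norm_nonneg _), @norm_sq_eq_re_inner ℂ, inner_pauliOp_pauliOp,
    ← @norm_sq_eq_re_inner ℂ]

theorem norm_inner_pauliOp_le {n : ℕ} (p : Fin n → PauliLabel) (v : QubitSpace n) :
    ‖inner ℂ v (pauliOp p v)‖ ≤ ‖v‖ ^ 2 := by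
  refine (norm_inner_le_norm _ _).trans_eq ?_
  rw [norm_pauliOp, sq]

/-! ### Eigenvector labels of a vector. -/

open Classical in
/-- The Pauli operators of which `v` is an eigenvector. -/
noncomputable def eigenLabels {n : ℕ} (v : QubitSpace n) : Finset (Fin n → PauliLabel) :=
  {p | ∃ θ : ℂ, pauliOp p v = θ • v}

theorem mem_eigenLabels {n : ℕ} {v : QubitSpace n} {p : Fin n → PauliLabel} :
    p ∈ eigenLabels v ↔ ∃ θ : ℂ, pauliOp p v = θ • v := by
  simp [eigenLabels]

theorem zero_mem_eigenLabels {n : ℕ} (v : QubitSpace n) : 0 ∈ eigenLabels v :=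
  mem_eigenLabels.mpr ⟨1, by rw [pauliOp_zero, one_smul]⟩

theorem add_mem_eigenLabels {n : ℕ} {v : QubitSpace n} {p q : Fin n → PauliLabel}
    (hp : p ∈ eigenLabels v) (hq : q ∈ eigenLabels v) : p + q ∈ eigenLabels v := by
  rw [mem_eigenLabels] at *
  obtain ⟨θ, hθ⟩ := hp
  obtain ⟨η, hη⟩ := hq
  have h := pauliOp_pauliOp p q v
  rw [hη, map_smul, hθ, smul_smul] at h
  refine ⟨(mulSign p q : ℂ)⁻¹ * (η * θ), ?_⟩
  rw [mul_smul, h, smul_smul, inv_mul_cancel₀ (mulSign_ne_zero p q), one_smul]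

theorem norm_eigenvalue {n : ℕ} {v : QubitSpace n} (hv : v ≠ 0) {p : Fin n → PauliLabel} {θ : ℂ}
    (h : pauliOp p v = θ • v) : ‖θ‖ = 1 := by
  have := congrArg norm h
  rw [norm_pauliOp, norm_smul] at this
  exact (mul_eq_right₀ (norm_ne_zero_iff.mpr hv)).mp this.symm

/-- Anticommuting operators with a common eigenvector would force the product of two unimodular
eigenvalues to equal its own negative. -/
theorem isotropic_eigenLabels {n : ℕ} {v : QubitSpace n} (hv : v ≠ 0) :
    Isotropic (eigenLabels v) := by
  refine ⟨fun p hp q hq => add_mem_eigenLabels hp hq, fun p hp q hq => ?_⟩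
  obtain ⟨θ, hθ⟩ := mem_eigenLabels.mp hp
  obtain ⟨η, hη⟩ := mem_eigenLabels.mp hq
  have hθ0 : θ ≠ 0 := norm_ne_zero_iff.mp (by rw [norm_eigenvalue hv hθ]; norm_num)
  have hη0 : η ≠ 0 := norm_ne_zero_iff.mp (by rw [norm_eigenvalue hv hη]; norm_num)
  rcases commSign_eq_one_or p q with h | h
  · exact h
  · have e := pauliOp_comm p q v
    rw [h, hη, map_smul, hθ, map_smul, hη, smul_smul, smul_smul, smul_smul] at e
    have e' := smul_left_injective ℂ hv e
    have h0 : 2 * (η * θ) = 0 := by push_cast at e'; linear_combination e'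
    simp [hθ0, hη0] at h0

/-- The vector `w` below is `A.card` times the projection of `v` onto the joint eigenspace
containing `u`. Hence `⟨u, w⟩ = A.card * ⟨u, v⟩`, and Cauchy–Schwarz reduces the claim to bounding
`‖w‖²`. -/
theorem norm_inner_sq_mul_card_le {n : ℕ} (u v : QubitSpace n) :
    ‖inner ℂ u v‖ ^ 2 * (eigenLabels u).card ≤
      ‖u‖ ^ 2 * ∑ a ∈ eigenLabels u, ‖inner ℂ v (pauliOp a v)‖ := by
  rcases eq_or_ne u 0 with rfl | hu
  · simp
  set A := eigenLabels u with hA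
  have hex : ∀ a, ∃ θ : ℂ, a ∈ A → pauliOp a u = θ • u := fun a => by
    by_cases h : a ∈ A
    · obtain ⟨θ, hθ⟩ := mem_eigenLabels.mp h
      exact ⟨θ, fun _ => hθ⟩
    · exact ⟨0, fun h' => absurd h' h⟩
  choose θ hθ using hex
  have hθ1 : ∀ a ∈ A, ‖θ a‖ = 1 := fun a ha => norm_eigenvalue hu (hθ a ha)
  set w : QubitSpace n := ∑ a ∈ A, (starRingEnd ℂ (θ a)) • pauliOp a v with hw
  have h1 : (A.card : ℂ) * inner ℂ u v = inner ℂ u w := by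
    rw [hw, inner_sum, ← nsmul_eq_mul, ← Finset.sum_const]
    refine Finset.sum_congr rfl fun a ha => ?_
    rw [inner_smul_right, ← inner_smul_left, ← hθ a ha, inner_pauliOp_pauliOp]
  have h2 : ‖w‖ ^ 2 ≤ A.card * ∑ a ∈ A, ‖inner ℂ v (pauliOp a v)‖ := by
    have e : ‖w‖ ^ 2 = ‖inner ℂ w w‖ := by
      rw [inner_self_eq_norm_sq_to_K]; simp
    rw [e, hw, sum_inner]
    refine (norm_sum_le _ _).trans ?_
    rw [← nsmul_eq_mul, ← Finset.sum_const]
    refine Finset.sum_le_sum fun a ha => ?_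
    rw [inner_sum]
    refine (norm_sum_le _ _).trans (le_of_eq ?_)
    -- For fixed `a`, translation by `a` permutes `A`, so each inner sum equals the same sum of
    -- expectations.
    refine Finset.sum_nbij' (fun b => a + b) (fun b => a + b)
      (fun b hb => add_mem_eigenLabels ha hb) (fun b hb => add_mem_eigenLabels ha hb)
      (fun b _ => pauliLabels_add_add_cancel a b) (fun b _ => pauliLabels_add_add_cancel a b) ?_
    intro b hb
    rw [inner_smul_left, inner_smul_right, norm_mul, norm_mul, norm_inner_pauliOp_pauliOp,
      RCLike.norm_conj, RCLike.norm_conj, RCLike.norm_conj, hθ1 a ha, hθ1 b hb, one_mul, one_mul]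
  have h3 : (A.card : ℝ) * ‖inner ℂ u v‖ ≤ ‖u‖ * ‖w‖ := by
    have := norm_inner_le_norm (𝕜 := ℂ) u w
    rwa [← h1, norm_mul, Complex.norm_natCast] at this
  have hc : (0 : ℝ) < A.card := by
    exact_mod_cast Finset.card_pos.mpr ⟨0, zero_mem_eigenLabels u⟩
  have h4 : ((A.card : ℝ) * ‖inner ℂ u v‖) ^ 2 ≤ (‖u‖ * ‖w‖) ^ 2 := by gcongr
  refine le_of_mul_le_mul_left ?_ hc
  calc (A.card : ℝ) * (‖inner ℂ u v‖ ^ 2 * A.card) = (A.card * ‖inner ℂ u v‖) ^ 2 := by ring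
    _ ≤ ‖u‖ ^ 2 * ‖w‖ ^ 2 := by rw [← mul_pow]; exact h4
    _ ≤ ‖u‖ ^ 2 * (A.card * ∑ a ∈ A, ‖inner ℂ v (pauliOp a v)‖) := by gcongr
    _ = _ := by ring

/-- Eigenvectors of a unitary with different eigenvalues are orthogonal, so here the two eigenvalues
agree. -/
theorem eigenLabels_inter_subset {n : ℕ} {u v : QubitSpace n} (huv : inner ℂ u v ≠ 0)
    {p : Fin n → PauliLabel} (hu : p ∈ eigenLabels u) (hv : p ∈ eigenLabels v) :
    p ∈ eigenLabels (u + v) := by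
  have hu0 : u ≠ 0 := by rintro rfl; simp at huv
  obtain ⟨θ, hθ⟩ := mem_eigenLabels.mp hu
  obtain ⟨η, hη⟩ := mem_eigenLabels.mp hv
  have h := inner_pauliOp_pauliOp p u v
  rw [hθ, hη, inner_smul_left, inner_smul_right, ← mul_assoc] at h
  have h1 : starRingEnd ℂ θ * η = 1 := (mul_eq_right₀ huv).mp h
  have h2 : θ * starRingEnd ℂ θ = 1 := by
    rw [Complex.mul_conj', norm_eigenvalue hu0 hθ]; norm_num
  have : η = θ := by linear_combination θ * h1 - η * h2
  exact mem_eigenLabels.mpr ⟨θ, by rw [map_add, hθ, hη, this, smul_add]⟩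

/-- Conjugating by the operator of `b` fixes the expectation in `v`, yet negates the operator of
`a`. -/
theorem inner_pauliOp_eq_zero {n : ℕ} {v : QubitSpace n} {a b : Fin n → PauliLabel}
    (hb : b ∈ eigenLabels v) (hab : commSign a b = -1) : inner ℂ v (pauliOp a v) = 0 := by
  rcases eq_or_ne v 0 with rfl | hv
  · simp
  obtain ⟨θ, hθ⟩ := mem_eigenLabels.mp hb
  have h := inner_pauliOp_pauliOp b v (pauliOp a v)
  rw [pauliOp_comm b a, commSign_comm, hab, hθ, map_smul, inner_smul_left, inner_smul_right,
    inner_smul_right] at h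
  have h2 : θ * starRingEnd ℂ θ = 1 := by
    rw [Complex.mul_conj', norm_eigenvalue hv hθ]; norm_num
  push_cast at h
  linear_combination (-1 / 2 : ℂ) * h - (1 / 2 : ℂ) * inner ℂ v (pauliOp a v) * h2

/-- The sumset `A + B` is isotropic, hence has at most `2 ^ n` elements, and each fibre of addition
on `A × B` injects into `A ∩ B`. -/
theorem card_mul_card_le_of_isotropic {n : ℕ} {A B : Finset (Fin n → PauliLabel)}
    (hA : Isotropic A) (hB : Isotropic B) (hAB : ∀ a ∈ A, ∀ b ∈ B, commSign a b = 1) :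
    A.card * B.card ≤ (A ∩ B).card * 2 ^ n := by
  classical
  set S := (A ×ˢ B).image fun x => x.1 + x.2 with hS
  have hSi : Isotropic S := by
    constructor
    · intro p hp q hq
      simp only [hS, Finset.mem_image, Finset.mem_product, Prod.exists] at hp hq ⊢
      obtain ⟨a, b, ⟨ha, hb⟩, rfl⟩ := hp
      obtain ⟨a', b', ⟨ha', hb'⟩, rfl⟩ := hq
      exact ⟨a + a', b + b', ⟨hA.add_mem a ha a' ha', hB.add_mem b hb b' hb'⟩,
        add_add_add_comm a a' b b'⟩
    · intro p hp q hq
      simp only [hS, Finset.mem_image, Finset.mem_product, Prod.exists] at hp hq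
      obtain ⟨a, b, ⟨ha, hb⟩, rfl⟩ := hp
      obtain ⟨a', b', ⟨ha', hb'⟩, rfl⟩ := hq
      rw [commSign_add_left, commSign_add_right, commSign_add_right, hA.comm a ha a' ha',
        hB.comm b hb b' hb', hAB a ha b' hb', commSign_comm b a', hAB a' ha' b hb]
      norm_num
  rw [← Finset.card_product]
  refine (Finset.card_le_mul_card_image (f := fun x => x.1 + x.2) (A ×ˢ B) (A ∩ B).card ?_).trans
    (Nat.mul_le_mul_left _ hSi.card_le)
  intro p hp
  simp only [Finset.mem_image, Finset.mem_product, Prod.exists] at hp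
  obtain ⟨a, b, ⟨ha, hb⟩, rfl⟩ := hp
  refine Finset.card_le_card_of_injOn (fun x => a + x.1) ?_ ?_
  · rintro ⟨a', b'⟩ h
    simp only [Finset.coe_filter, Finset.mem_product, Set.mem_ofPred_eq] at h
    obtain ⟨⟨ha', hb'⟩, h⟩ := h
    have e : a + a' = b + b' := by
      calc a + a' = a + (a' + b') + b' := by
            rw [add_assoc, add_assoc, pauliLabels_add_self, add_zero]
        _ = b + b' := by rw [h, pauliLabels_add_add_cancel]
    simp only [Finset.coe_inter, Set.mem_inter_iff, Finset.mem_coe]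
    exact ⟨hA.add_mem a ha a' ha', e ▸ hB.add_mem b hb b' hb'⟩
  · rintro ⟨a₁, b₁⟩ h₁ ⟨a₂, b₂⟩ h₂ h
    simp only [Finset.coe_filter, Finset.mem_product, Set.mem_ofPred_eq] at h₁ h₂ h
    have h3 := add_left_cancel h
    subst h3
    have h4 := add_left_cancel (h₁.2.trans h₂.2.symm)
    rw [h4]

/-- A label of `u` that anticommutes with some label of `v` has zero expectation in `v`. So only the
subgroup `A'` commuting with all of `B` contributes to the overlap bound, and large overlap makes
`A'` at least a `1/Q` fraction of `A`. Then `A' ∩ B` is large by counting, and it consists of labels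
of `u + v`. -/
theorem two_pow_le_card_eigenLabels_add {n : ℕ} {u v : QubitSpace n} {D E Q : ℝ} (hD0 : 0 ≤ D)
    (hE0 : 0 ≤ E) (hD : 2 ^ n ≤ D * (eigenLabels u).card) (hE : 2 ^ n ≤ E * (eigenLabels v).card)
    (h : ‖u‖ ^ 2 * ‖v‖ ^ 2 < Q * ‖inner ℂ u v‖ ^ 2) :
    2 ^ n ≤ D * E * Q * (eigenLabels (u + v)).card := by
  classical
  have huv : inner ℂ u v ≠ 0 := by
    intro h0
    rw [h0] at h
    have : 0 ≤ ‖u‖ ^ 2 * ‖v‖ ^ 2 := by positivity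
    norm_num at h
    linarith
  have hu : u ≠ 0 := by rintro rfl; simp at huv
  have hv : v ≠ 0 := by rintro rfl; simp at huv
  set A := eigenLabels u
  set B := eigenLabels v
  set A' := A.filter fun a => ∀ b ∈ B, commSign a b = 1 with hA'
  have hp : 0 < ‖inner ℂ u v‖ ^ 2 := by positivity
  have hQ : 0 ≤ Q := by
    by_contra hQ
    have : 0 ≤ ‖u‖ ^ 2 * ‖v‖ ^ 2 := by positivity
    nlinarith
  have hAi : Isotropic A := isotropic_eigenLabels hu
  have hA'i : Isotropic A' := by
    constructor
    · intro p hp q hq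
      simp only [hA', Finset.mem_filter] at hp hq ⊢
      refine ⟨hAi.add_mem p hp.1 q hq.1, fun b hb => ?_⟩
      rw [commSign_add_left, hp.2 b hb, hq.2 b hb, one_mul]
    · intro p hp q hq
      exact hAi.comm p (Finset.mem_filter.mp hp).1 q (Finset.mem_filter.mp hq).1
  have h1 : (A'.card : ℝ) * B.card ≤ (eigenLabels (u + v)).card * 2 ^ n := by
    have := card_mul_card_le_of_isotropic hA'i (isotropic_eigenLabels hv)
      fun a ha b hb => (Finset.mem_filter.mp ha).2 b hb
    have h2 : (A' ∩ B).card ≤ (eigenLabels (u + v)).card := by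
      refine Finset.card_le_card fun p hp => ?_
      rw [Finset.mem_inter] at hp
      exact eigenLabels_inter_subset huv (Finset.mem_filter.mp hp.1).1 hp.2
    exact_mod_cast this.trans (Nat.mul_le_mul_right _ h2)
  have h2 : ∑ a ∈ A, ‖inner ℂ v (pauliOp a v)‖ ≤ A'.card * ‖v‖ ^ 2 := by
    rw [← nsmul_eq_mul, ← Finset.sum_const, hA', Finset.sum_filter]
    refine Finset.sum_le_sum fun a _ => ?_
    split_ifs with hab
    · exact norm_inner_pauliOp_le a v
    · push Not at hab
      obtain ⟨b, hb, hab⟩ := hab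
      rw [inner_pauliOp_eq_zero hb ((commSign_eq_one_or a b).resolve_left hab), norm_zero]
  have h3 : (A.card : ℝ) ≤ Q * A'.card := by
    refine le_of_mul_le_mul_left ?_ hp
    calc ‖inner ℂ u v‖ ^ 2 * A.card ≤ ‖u‖ ^ 2 * ∑ a ∈ A, ‖inner ℂ v (pauliOp a v)‖ :=
          norm_inner_sq_mul_card_le u v
      _ ≤ ‖u‖ ^ 2 * (A'.card * ‖v‖ ^ 2) := by gcongr
      _ = (‖u‖ ^ 2 * ‖v‖ ^ 2) * A'.card := by ring
      _ ≤ (Q * ‖inner ℂ u v‖ ^ 2) * A'.card := by gcongr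
      _ = _ := by ring
  refine le_of_mul_le_mul_right ?_ (show (0 : ℝ) < 2 ^ n by positivity)
  calc (2 : ℝ) ^ n * 2 ^ n ≤ (D * A.card) * (E * B.card) := by gcongr
    _ ≤ (D * (Q * A'.card)) * (E * B.card) := by gcongr
    _ = D * E * Q * (A'.card * B.card) := by ring
    _ ≤ D * E * Q * ((eigenLabels (u + v)).card * 2 ^ n) := by gcongr
    _ = _ := by ring

/-! ### Overlap with the magic state. -/

theorem inner_tensorPower {n : ℕ} (A : Fin n → Matrix (Fin 2) (Fin 2) ℂ)
    (φ : EuclideanSpace ℂ (Fin 2)) :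
    inner ℂ (tensorPower φ n) (Matrix.toEuclideanLin (tensorMatrix A) (tensorPower φ n)) =
      ∏ i, inner ℂ φ (Matrix.toEuclideanLin (A i) φ) := by
  have h := tensorMatrix_mulVec A fun _ => φ.ofLp
  simp only [tensorPower, EuclideanSpace.inner_eq_star_dotProduct, Matrix.toLpLin_apply, h,
    dotProduct]
  rw [Finset.prod_univ_sum, Fintype.piFinset_univ]
  refine Finset.sum_congr rfl fun x _ => ?_
  simp [Finset.prod_mul_distrib]

theorem cos_pi_div_eight_sq_sub : Real.cos (Real.pi / 8) ^ 2 - Real.sin (Real.pi / 8) ^ 2 = 1 / √2 := by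
  rw [← Real.cos_two_mul', show 2 * (Real.pi / 8) = Real.pi / 4 by ring, Real.cos_pi_div_four,
    div_eq_div_iff (by norm_num) (by positivity), Real.mul_self_sqrt (by norm_num)]
  norm_num

theorem norm_inner_ketH (x : PauliLabel) :
    ‖inner ℂ ketH (Matrix.toEuclideanLin (pauli₁ x) ketH)‖ = magicWeight x := by
  have hc := cos_pi_div_eight_sq_sub
  have hs : 2 * (Real.sin (Real.pi / 8) * Real.cos (Real.pi / 8)) = 1 / √2 := by
    rw [← mul_assoc, ← Real.sin_two_mul, show 2 * (Real.pi / 8) = Real.pi / 4 by ring,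
      Real.sin_pi_div_four, div_eq_div_iff (by norm_num) (by positivity),
      Real.mul_self_sqrt (by norm_num)]
    norm_num
  have h1 := Real.cos_sq_add_sin_sq (Real.pi / 8)
  have hr : 0 ≤ 1 / √2 := by positivity
  have key : inner ℂ ketH (Matrix.toEuclideanLin (pauli₁ x) ketH) =
      ((pauliEntry x 0 0 * Real.cos (Real.pi / 8) ^ 2 +
        pauliEntry x 1 1 * Real.sin (Real.pi / 8) ^ 2 +
        (pauliEntry x 0 1 + pauliEntry x 1 0 : ℤ) *
          (Real.sin (Real.pi / 8) * Real.cos (Real.pi / 8)) : ℝ) : ℂ) := by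
    simp only [ketH, EuclideanSpace.inner_eq_star_dotProduct, Matrix.toLpLin_apply, dotProduct,
      Matrix.mulVec, Fin.sum_univ_two, pauli₁, Matrix.of_apply]
    simp [-Complex.ofReal_cos, -Complex.ofReal_sin]
    ring
  rw [key, Complex.norm_real, magicWeight]
  generalize Real.cos (Real.pi / 8) = c at *
  generalize Real.sin (Real.pi / 8) = s at *
  generalize 1 / √2 = r at *
  clear key
  fin_cases x
  · simp [pauliEntry, h1]
  · simp [pauliEntry, ← sub_eq_add_neg, hc, hr]
  · simp [pauliEntry, one_add_one_eq_two, -norm_mul, hs, hr]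
  · simp [pauliEntry]

theorem norm_inner_tensorPower_sq_le {n : ℕ} (v : QubitSpace n) {D : ℝ} (hD0 : 0 ≤ D)
    (hD : 2 ^ n ≤ D * (eigenLabels v).card) :
    ‖inner ℂ v (tensorPower ketH n)‖ ^ 2 ≤ ‖v‖ ^ 2 * D * (Real.cos (Real.pi / 8) ^ 2) ^ n := by
  rcases eq_or_ne v 0 with rfl | hv
  · simp
  have h1 : ∑ a ∈ eigenLabels v, ‖inner ℂ (tensorPower ketH n) (pauliOp a (tensorPower ketH n))‖ ≤
      (1 + 1 / √2) ^ n := by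
    refine le_of_eq_of_le (Finset.sum_congr rfl fun a _ => ?_)
      (isotropic_eigenLabels hv).sum_magicWeight_le
    rw [pauliOp, pauli, inner_tensorPower, norm_prod]
    exact Finset.prod_congr rfl fun i _ => norm_inner_ketH (a i)
  have hcos : 1 + 1 / √2 = 2 * Real.cos (Real.pi / 8) ^ 2 := by
    linarith [cos_pi_div_eight_sq_sub, Real.cos_sq_add_sin_sq (Real.pi / 8)]
  have h2 := norm_inner_sq_mul_card_le v (tensorPower ketH n)
  refine le_of_mul_le_mul_left ?_ (show (0 : ℝ) < 2 ^ n by positivity)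
  calc (2 : ℝ) ^ n * ‖inner ℂ v (tensorPower ketH n)‖ ^ 2
      ≤ D * (eigenLabels v).card * ‖inner ℂ v (tensorPower ketH n)‖ ^ 2 := by gcongr
    _ = D * (‖inner ℂ v (tensorPower ketH n)‖ ^ 2 * (eigenLabels v).card) := by ring
    _ ≤ D * (‖v‖ ^ 2 * (1 + 1 / √2) ^ n) := by
        exact mul_le_mul_of_nonneg_left (h2.trans (by gcongr)) hD0
    _ = _ := by rw [hcos, mul_pow]; ring

/-! ### Nearly orthogonal families and the merging induction. -/

theorem sum_norm_sq_le_two_mul {n k : ℕ} {ι : Type*} (hk : 0 < k) (s : Finset ι)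
    (hs : s.card ≤ k) (v : ι → QubitSpace n)
    (h : ∀ i ∈ s, ∀ j ∈ s, i ≠ j →
      4 * (k : ℝ) ^ 2 * ‖inner ℂ (v i) (v j)‖ ^ 2 ≤ ‖v i‖ ^ 2 * ‖v j‖ ^ 2) :
    ∑ i ∈ s, ‖v i‖ ^ 2 ≤ 2 * ‖∑ i ∈ s, v i‖ ^ 2 := by
  classical
  have hk' : (0 : ℝ) < k := by exact_mod_cast hk
  -- The correction is subtracted on the diagonal too, so that the corrections sum to the full
  -- square `(∑ ‖v i‖)² / (2k)`, at most half of `∑ ‖v i‖²`.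
  have hterm : ∀ i ∈ s, ∀ j ∈ s, (if i = j then ‖v i‖ ^ 2 else 0) - ‖v i‖ * ‖v j‖ / (2 * k) ≤
      (inner ℂ (v i) (v j)).re := by
    intro i hi j hj
    split_ifs with hij
    · subst hij
      have e : (inner ℂ (v i) (v i)).re = ‖v i‖ ^ 2 := (@norm_sq_eq_re_inner ℂ _ _ _ _ (v i)).symm
      rw [e]
      have : 0 ≤ ‖v i‖ * ‖v i‖ / (2 * k) := by positivity
      linarith
    · have h1 : (2 * k * ‖inner ℂ (v i) (v j)‖) ^ 2 ≤ (‖v i‖ * ‖v j‖) ^ 2 := by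
        have := h i hi j hj hij
        nlinarith
      have h2 := (sq_le_sq₀ (by positivity) (by positivity)).mp h1
      have h3 : ‖inner ℂ (v i) (v j)‖ ≤ ‖v i‖ * ‖v j‖ / (2 * k) := by
        rw [le_div_iff₀ (by positivity)]; linarith
      have h4 := (abs_le.mp (Complex.abs_re_le_norm (inner ℂ (v i) (v j)))).1
      linarith
  have e : ‖∑ i ∈ s, v i‖ ^ 2 = ∑ i ∈ s, ∑ j ∈ s, (inner ℂ (v i) (v j)).re := by
    rw [@norm_sq_eq_re_inner ℂ, sum_inner]
    simp only [inner_sum, RCLike.re_eq_complex_re, Complex.re_sum]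
  have hlow : ∑ i ∈ s, ‖v i‖ ^ 2 - (∑ i ∈ s, ‖v i‖) ^ 2 / (2 * k) ≤ ‖∑ i ∈ s, v i‖ ^ 2 := by
    rw [e]
    refine le_trans (le_of_eq ?_) (Finset.sum_le_sum fun i hi => Finset.sum_le_sum (hterm i hi))
    simp only [Finset.sum_sub_distrib, Finset.sum_ite_eq]
    rw [sq (∑ i ∈ s, ‖v i‖), Finset.sum_mul_sum, Finset.sum_div]
    simp only [Finset.sum_div]
    congr 1
    exact Finset.sum_congr rfl fun i hi => by rw [if_pos hi]
  have hcs : (∑ i ∈ s, ‖v i‖) ^ 2 ≤ k * ∑ i ∈ s, ‖v i‖ ^ 2 := by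
    refine sq_sum_le_card_mul_sum_sq.trans (mul_le_mul_of_nonneg_right ?_ ?_)
    · exact_mod_cast hs
    · exact Finset.sum_nonneg fun i _ => sq_nonneg _
  have : (∑ i ∈ s, ‖v i‖) ^ 2 / (2 * k) ≤ (∑ i ∈ s, ‖v i‖ ^ 2) / 2 := by
    rw [div_le_div_iff₀ (by positivity) (by norm_num)]
    linarith
  linarith

/-- The bound `k` stays fixed while `s` shrinks, so the merging threshold never changes. A merge
removes one index and multiplies `∏ D` by `4k²`, leaving the right-hand side unchanged. -/
theorem norm_inner_sum_sq_le {n k : ℕ} {ι : Type*} (hk : 0 < k) (s : Finset ι)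
    (hs : s.card ≤ k) (v : ι → QubitSpace n) (D : ι → ℝ) (hD1 : ∀ i ∈ s, 1 ≤ D i)
    (hD : ∀ i ∈ s, 2 ^ n ≤ D i * (eigenLabels (v i)).card) :
    ‖inner ℂ (∑ i ∈ s, v i) (tensorPower ketH n)‖ ^ 2 ≤
      2 * k * ‖∑ i ∈ s, v i‖ ^ 2 * ((4 * (k : ℝ) ^ 2) ^ s.card * ∏ i ∈ s, D i) *
        (Real.cos (Real.pi / 8) ^ 2) ^ n := by
  classical
  have hk' : (1 : ℝ) ≤ k := by exact_mod_cast hk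
  have hQ : (1 : ℝ) ≤ 4 * (k : ℝ) ^ 2 := by nlinarith
  induction hm : s.card generalizing s v D with
  | zero =>
    rw [Finset.card_eq_zero] at hm
    subst hm
    simp
  | succ m ih =>
    by_cases H : ∃ i ∈ s, ∃ j ∈ s, i ≠ j ∧
        ‖v i‖ ^ 2 * ‖v j‖ ^ 2 < 4 * (k : ℝ) ^ 2 * ‖inner ℂ (v i) (v j)‖ ^ 2
    · obtain ⟨i, hi, j, hj, hij, hlt⟩ := H
      -- The merged vector is stored at index `i`, and `j` is dropped.
      have hi' : i ∈ s.erase j := Finset.mem_erase.mpr ⟨hij, hi⟩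
      have hsum : ∑ l ∈ s.erase j, Function.update v i (v i + v j) l = ∑ l ∈ s, v l := by
        rw [Finset.sum_update_of_mem hi', Finset.sdiff_singleton_eq_erase,
          ← Finset.add_sum_erase s v hj, ← Finset.add_sum_erase (s.erase j) v hi']
        abel
      have hprod : ∏ l ∈ s.erase j, Function.update D i (D i * D j * (4 * (k : ℝ) ^ 2)) l =
          4 * (k : ℝ) ^ 2 * ∏ l ∈ s, D l := by
        rw [Finset.prod_update_of_mem hi', Finset.sdiff_singleton_eq_erase,
          ← Finset.mul_prod_erase s D hj, ← Finset.mul_prod_erase (s.erase j) D hi']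
        ring
      have hcard : (s.erase j).card = m := by rw [Finset.card_erase_of_mem hj, hm]; rfl
      have := ih (s.erase j) (by omega) (Function.update v i (v i + v j))
        (Function.update D i (D i * D j * (4 * (k : ℝ) ^ 2))) ?_ ?_ hcard
      · rw [hsum, hprod] at this
        refine this.trans (le_of_eq ?_)
        rw [pow_succ]
        ring
      · intro l hl
        rcases eq_or_ne l i with rfl | hli
        · rw [Function.update_self]
          exact one_le_mul_of_one_le_of_one_le
            (one_le_mul_of_one_le_of_one_le (hD1 l hi) (hD1 j hj)) hQ
        · rw [Function.update_of_ne hli]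
          exact hD1 l (Finset.mem_of_mem_erase hl)
      · intro l hl
        rcases eq_or_ne l i with rfl | hli
        · rw [Function.update_self, Function.update_self]
          exact two_pow_le_card_eigenLabels_add (zero_le_one.trans (hD1 l hi))
            (zero_le_one.trans (hD1 j hj)) (hD l hi) (hD j hj) hlt
        · rw [Function.update_of_ne hli, Function.update_of_ne hli]
          exact hD l (Finset.mem_of_mem_erase hl)
    · push Not at H
      have h1 := sum_norm_sq_le_two_mul hk s hs v H
      set ρ := (Real.cos (Real.pi / 8) ^ 2) ^ n
      have hρ : 0 ≤ ρ := by positivity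
      set P := ∏ i ∈ s, D i
      have hDP : ∀ i ∈ s, D i ≤ P := fun i hi => by
        have h := Finset.mul_prod_erase s D hi
        have h' : 1 ≤ ∏ l ∈ s.erase i, D l :=
          Finset.one_le_prod fun l hl => hD1 l (Finset.mem_of_mem_erase hl)
        have := hD1 i hi
        nlinarith
      have hP : 1 ≤ P := Finset.one_le_prod hD1
      have hQm : 1 ≤ (4 * (k : ℝ) ^ 2) ^ (m + 1) := one_le_pow₀ hQ
      have h2 : ‖inner ℂ (∑ i ∈ s, v i) (tensorPower ketH n)‖ ≤
          ∑ i ∈ s, ‖inner ℂ (v i) (tensorPower ketH n)‖ := by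
        rw [sum_inner]; exact norm_sum_le _ _
      calc ‖inner ℂ (∑ i ∈ s, v i) (tensorPower ketH n)‖ ^ 2
          ≤ (∑ i ∈ s, ‖inner ℂ (v i) (tensorPower ketH n)‖) ^ 2 := by gcongr
        _ ≤ s.card * ∑ i ∈ s, ‖inner ℂ (v i) (tensorPower ketH n)‖ ^ 2 :=
            sq_sum_le_card_mul_sum_sq
        _ ≤ k * ∑ i ∈ s, ‖v i‖ ^ 2 * P * ρ := by
            gcongr with i hi
            refine (norm_inner_tensorPower_sq_le (v i) (zero_le_one.trans (hD1 i hi))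
              (hD i hi)).trans ?_
            gcongr
            exact hDP i hi
        _ = k * (∑ i ∈ s, ‖v i‖ ^ 2) * (1 * P) * ρ := by
            rw [← Finset.sum_mul, ← Finset.sum_mul]; ring
        _ ≤ k * (2 * ‖∑ i ∈ s, v i‖ ^ 2) * ((4 * (k : ℝ) ^ 2) ^ (m + 1) * P) * ρ := by gcongr
        _ = _ := by ring

/-! ### Clifford operators permute the Pauli operators. -/

/-- Conjugation by `U` permutes the Pauli operators, up to scalars. -/
def PermutesPaulis {n : ℕ} (U : Matrix (Fin n → Fin 2) (Fin n → Fin 2) ℂ) : Prop :=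
  ∃ π : Equiv.Perm (Fin n → PauliLabel), ∀ p, ∃ θ : ℂ, θ ≠ 0 ∧
    U * pauli p = θ • (pauli (π p) * U)

theorem permutesPaulis_applyOn_oneQubit {n : ℕ} (f : Fin 1 ↪ Fin n)
    (B : Matrix (Fin 2) (Fin 2) ℂ) (τ : Equiv.Perm PauliLabel)
    (h : ∀ x, ∃ θ : ℂ, θ ≠ 0 ∧ B * pauli₁ x = θ • (pauli₁ (τ x) * B)) :
    PermutesPaulis (applyOn f (oneQubit B)) := by
  choose θ hθ0 hθ using h
  refine ⟨Equiv.piCongrRight fun i => if i = f 0 then τ else 1, fun p =>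
    ⟨∏ i, if i = f 0 then θ (p i) else 1, ?_, ?_⟩⟩
  · refine Finset.prod_ne_zero_iff.mpr fun i _ => ?_
    split_ifs
    exacts [hθ0 _, one_ne_zero]
  · rw [applyOn_oneQubit, pauli, pauli, tensorMatrix_mul, tensorMatrix_mul, ← tensorMatrix_smul]
    congr 1
    funext i
    by_cases hi : i = f 0
    · simp only [hi, if_true, Equiv.piCongrRight_apply, Pi.map_apply, hθ]
    · simp [hi]

theorem permutesPaulis_gateS {n : ℕ} (f : Fin 1 ↪ Fin n) :
    PermutesPaulis (applyUnitaryOn f gateS).1 := by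
  have hinv : Function.Involutive fun x : PauliLabel => (x.1, x.2 + x.1) := by
    intro x; revert x; decide
  refine permutesPaulis_applyOn_oneQubit f _ hinv.toPerm fun x =>
    ⟨if x.1 = 0 then 1 else Complex.I, by split_ifs <;> simp, ?_⟩
  ext a b
  fin_cases x <;> fin_cases a <;> fin_cases b <;>
    simp [pauli₁, pauliEntry, Matrix.mul_apply, Function.Involutive.toPerm]

theorem permutesPaulis_gateH {n : ℕ} (f : Fin 1 ↪ Fin n) :
    PermutesPaulis (applyUnitaryOn f gateH).1 := by
  refine permutesPaulis_applyOn_oneQubit f _ (Equiv.prodComm _ _) fun x =>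
    ⟨if x = (1, 1) then -1 else 1, by split_ifs <;> simp, ?_⟩
  ext a b
  fin_cases x <;> fin_cases a <;> fin_cases b <;>
    simp [pauli₁, pauliEntry, Matrix.mul_apply]

/-- The action of `CX` with control `c` and target `t` on bit strings. -/
def flipTarget {n : ℕ} (c t : Fin n) (x : Fin n → Fin 2) : Fin n → Fin 2 :=
  Function.update x t (x c + x t)

theorem flipTarget_involutive {n : ℕ} {c t : Fin n} (hct : c ≠ t) :
    Function.Involutive (flipTarget c t) := by
  intro x
  have h : ∀ a b : Fin 2, a + (a + b) = b := by decide
  simp [flipTarget, Function.update_of_ne hct, h]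

theorem applyUnitaryOn_gateCX {n : ℕ} (f : Fin 2 ↪ Fin n) :
    (applyUnitaryOn f gateCX).1 =
      Matrix.of fun x y => if x = flipTarget (f 0) (f 1) y then 1 else 0 := by
  classical
  have h01 : f 0 ≠ f 1 := f.injective.ne (by decide)
  ext x y
  simp only [applyUnitaryOn, applyOn, gateCX, Matrix.of_apply, ← ite_and]
  refine if_congr ⟨fun ⟨h1, h2⟩ => ?_, ?_⟩ rfl rfl
  · have e0 := congrFun h2 0
    have e1 := congrFun h2 1
    simp only [Function.comp_apply, Matrix.cons_val_zero, Matrix.cons_val_one] at e0 e1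
    funext i
    by_cases hi1 : i = f 1
    · subst hi1; simpa [flipTarget] using e1
    by_cases hi0 : i = f 0
    · subst hi0; simpa [flipTarget, h01] using e0
    rw [flipTarget, Function.update_of_ne hi1]
    refine h1 i ?_
    rintro ⟨j, rfl⟩
    fin_cases j
    exacts [hi0 rfl, hi1 rfl]
  · rintro rfl
    constructor
    · intro i hi
      rw [flipTarget, Function.update_of_ne]
      rintro rfl
      exact hi ⟨1, rfl⟩
    · funext j
      fin_cases j
      · simp [flipTarget, h01]
      · simp [flipTarget]

theorem permutesPaulis_gateCX {n : ℕ} (f : Fin 2 ↪ Fin n) :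
    PermutesPaulis (applyUnitaryOn f gateCX).1 := by
  classical
  have hct : f 0 ≠ f 1 := f.injective.ne (by decide)
  rw [applyUnitaryOn_gateCX]
  generalize f 0 = c at *
  generalize f 1 = t at *
  have hσ := flipTarget_involutive hct
  -- `CX` copies the `X` part from control to target and the `Z` part from target to control. In the
  -- ordering `X ^ x * Z ^ z` no sign appears, so the scalar is `1`.
  have hinv : Function.Involutive fun p : Fin n → PauliLabel =>
      Function.update (Function.update p c ((p c).1, (p c).2 + (p t).2)) t
        ((p c).1 + (p t).1, (p t).2) := by
    intro p
    have h1 : ∀ a b : Fin 2, a + (a + b) = b := by decide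
    have h2 : ∀ a b : Fin 2, a + b + b = a := by decide
    funext i
    by_cases hit : i = t
    · subst hit; simp [hct, h1]
    by_cases hic : i = c
    · subst hic; simp [hct, h2]
    simp [hit, hic]
  refine ⟨hinv.toPerm, fun p => ⟨1, one_ne_zero, ?_⟩⟩
  have hent : ∀ (x y : PauliLabel) (a b a' b' : Fin 2),
      pauliEntry x a b * pauliEntry y (a + a') b' =
        pauliEntry (x.1, x.2 + y.2) a b * pauliEntry (x.1 + y.1, y.2) a' (b + b') := by decide
  have hsplit : ∀ g : Fin n → ℂ, ∏ i, g i = g c * g t * ∏ i ∈ (Finset.univ.erase c).erase t, g i := by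
    intro g
    rw [mul_assoc, Finset.mul_prod_erase _ g (Finset.mem_erase.mpr ⟨hct.symm, Finset.mem_univ t⟩),
      Finset.mul_prod_erase _ g (Finset.mem_univ c)]
  rw [one_smul]
  ext x y
  simp only [Matrix.mul_apply, Matrix.of_apply, mul_ite, ite_mul, one_mul, zero_mul, mul_one,
    mul_zero, Finset.sum_ite_eq', Finset.mem_univ, if_true]
  rw [Finset.sum_congr rfl fun z _ => if_congr (⟨fun h => by rw [h, hσ], fun h => by rw [h, hσ]⟩ :
    x = flipTarget c t z ↔ z = flipTarget c t x) rfl rfl]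
  simp only [Finset.sum_ite_eq', Finset.mem_univ, if_true, pauli, tensorMatrix, Matrix.of_apply,
    pauli₁]
  rw [hsplit, hsplit]
  congr 1
  · have := hent (p c) (p t) (x c) (y c) (x t) (y t)
    simp [flipTarget, hct, Function.Involutive.toPerm]
    exact_mod_cast this
  · refine Finset.prod_congr rfl fun i hi => ?_
    simp only [Finset.mem_erase, Finset.mem_univ, and_true] at hi
    simp [flipTarget, hi.1, hi.2, Function.Involutive.toPerm]

theorem permutesPaulis_of_mem_cliffordGroup {n : ℕ} {C : QubitUnitary n}
    (hC : C ∈ cliffordGroup n) : PermutesPaulis C.1 := by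
  induction hC using Subgroup.closure_induction with
  | mem U hU =>
    rcases hU with (⟨f, rfl⟩ | ⟨f, rfl⟩) | ⟨f, rfl⟩
    exacts [permutesPaulis_gateS f, permutesPaulis_gateH f, permutesPaulis_gateCX f]
  | one => exact ⟨1, fun p => ⟨1, one_ne_zero, by simp⟩⟩
  | mul U V _ _ hU hV =>
    obtain ⟨π, hπ⟩ := hU
    obtain ⟨τ, hτ⟩ := hV
    refine ⟨τ.trans π, fun p => ?_⟩
    obtain ⟨θ, hθ0, hθ⟩ := hτ p
    obtain ⟨η, hη0, hη⟩ := hπ (τ p)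
    refine ⟨θ * η, mul_ne_zero hθ0 hη0, ?_⟩
    change U.1 * V.1 * _ = _ • (_ * (U.1 * V.1))
    rw [mul_assoc, hθ, mul_smul_comm, ← mul_assoc, hη, smul_mul_assoc, smul_smul, mul_assoc]
    rfl
  | inv U _ hU =>
    obtain ⟨π, hπ⟩ := hU
    refine ⟨π.symm, fun p => ?_⟩
    obtain ⟨θ, hθ0, hθ⟩ := hπ (π.symm p)
    rw [Equiv.apply_symm_apply] at hθ
    refine ⟨θ⁻¹, inv_ne_zero hθ0, ?_⟩
    have h1 : (U⁻¹).1 * U.1 = 1 := congrArg Subtype.val (inv_mul_cancel U)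
    have h2 : U.1 * (U⁻¹).1 = 1 := congrArg Subtype.val (mul_inv_cancel U)
    have h3 : θ⁻¹ • (U.1 * pauli (π.symm p)) = pauli p * U.1 := by
      rw [hθ, smul_smul, inv_mul_cancel₀ hθ0, one_smul]
    calc (U⁻¹).1 * pauli p = (U⁻¹).1 * (pauli p * U.1) * (U⁻¹).1 := by
          rw [← mul_assoc, mul_assoc _ U.1, h2, mul_one]
      _ = _ := by
          rw [← h3, mul_smul_comm, ← mul_assoc, h1, one_mul, smul_mul_assoc]

theorem card_eigenLabels_le_act {n : ℕ} {U : QubitUnitary n} (hU : PermutesPaulis U.1)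
    (v : QubitSpace n) : (eigenLabels v).card ≤ (eigenLabels (U.act v)).card := by
  obtain ⟨π, hπ⟩ := hU
  refine Finset.card_le_card_of_injOn π (fun p hp => ?_) π.injective.injOn
  obtain ⟨η, hη⟩ := mem_eigenLabels.mp hp
  obtain ⟨θ, hθ0, hθ⟩ := hπ p
  refine mem_eigenLabels.mpr ⟨θ⁻¹ * η, ?_⟩
  have e : θ • pauliOp (π p) (U.act v) = η • U.act v := by
    have := congrArg (fun M => Matrix.toEuclideanLin M v) hθ
    simp only [map_smul, Matrix.toLpLin_mul_same, LinearMap.smul_apply, LinearMap.comp_apply] at this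
    change Matrix.toEuclideanLin U.1 (pauliOp p v) = θ • pauliOp (π p) (U.act v) at this
    rw [← this, hη, map_smul]
    rfl
  rw [mul_smul, ← e, smul_smul, inv_mul_cancel₀ hθ0, one_smul]

/-! ### Stabilizer states: many labels, and spanning. -/

/-- The computational basis state `|x⟩`. -/
noncomputable def basisKet {n : ℕ} (x : Fin n → Fin 2) : QubitSpace n := EuclideanSpace.single x 1

theorem basisKet_eq_prod {n : ℕ} (x : Fin n → Fin 2) :
    basisKet x = WithLp.toLp 2 fun y => ∏ i, (Pi.single (x i) 1 : Fin 2 → ℂ) (y i) := by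
  ext y
  simp only [basisKet, PiLp.single_apply, Pi.single_apply, Finset.prod_ite_zero]
  simp [funext_iff]

theorem toEuclideanLin_tensorMatrix_basisKet {n : ℕ} {A : Fin n → Matrix (Fin 2) (Fin 2) ℂ}
    {x y : Fin n → Fin 2} (h : ∀ i, A i *ᵥ Pi.single (x i) 1 = Pi.single (y i) 1) :
    Matrix.toEuclideanLin (tensorMatrix A) (basisKet x) = basisKet y := by
  rw [basisKet_eq_prod, basisKet_eq_prod, Matrix.toLpLin_apply]
  congr 1
  refine (tensorMatrix_mulVec A fun i => (Pi.single (x i) 1 : Fin 2 → ℂ)).trans ?_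
  simp only [h]

theorem two_pow_le_card_eigenLabels_ketZero (n : ℕ) : 2 ^ n ≤ (eigenLabels (ketZero n)).card := by
  have : 2 ^ n = (Finset.univ : Finset (Fin n → Fin 2)).card := by simp
  rw [this]
  -- The `2 ^ n` products of `Z` operators all fix `|0ⁿ⟩`.
  refine Finset.card_le_card_of_injOn (fun z i => (0, z i)) (fun z _ => ?_) ?_
  · refine mem_eigenLabels.mpr ⟨1, ?_⟩
    rw [one_smul]
    refine toEuclideanLin_tensorMatrix_basisKet (x := fun _ => 0) (y := fun _ => 0) fun i => ?_
    ext a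
    fin_cases a <;> simp [pauli₁, pauliEntry]
  · intro z _ z' _ h
    funext i
    exact congrArg Prod.snd (congrFun h i)

theorem two_pow_le_card_eigenLabels_of_mem_stabilizerStates {n : ℕ} {s : QubitSpace n}
    (hs : s ∈ stabilizerStates n) : 2 ^ n ≤ (eigenLabels s).card := by
  obtain ⟨C, hC, rfl⟩ := hs
  exact (two_pow_le_card_eigenLabels_ketZero n).trans
    (card_eigenLabels_le_act (permutesPaulis_of_mem_cliffordGroup hC) _)

theorem card_eigenLabels_le_smul {n : ℕ} (c : ℂ) (v : QubitSpace n) :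
    (eigenLabels v).card ≤ (eigenLabels (c • v)).card := by
  refine Finset.card_le_card fun p hp => ?_
  obtain ⟨θ, hθ⟩ := mem_eigenLabels.mp hp
  exact mem_eigenLabels.mpr ⟨θ, by rw [map_smul, hθ, smul_comm]⟩

theorem act_eq_toEuclideanLin {n : ℕ} (U : QubitUnitary n) (v : QubitSpace n) :
    U.act v = Matrix.toEuclideanLin U.1 v := rfl

theorem act_mem_stabilizerStates {n : ℕ} {C : QubitUnitary n} (hC : C ∈ cliffordGroup n)
    {s : QubitSpace n} (hs : s ∈ stabilizerStates n) : C.act s ∈ stabilizerStates n := by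
  obtain ⟨C', hC', rfl⟩ := hs
  refine ⟨C * C', mul_mem hC hC', ?_⟩
  simp [QubitUnitary.act, Matrix.mulVec_mulVec]

/-- The operator `X = H S² H` on the qubit `j`, which belongs to the Clifford group. -/
theorem exists_cliffordGroup_flip {n : ℕ} (j : Fin n) : ∃ C ∈ cliffordGroup n,
    C.1 = tensorMatrix fun i => if i = j then !![0, 1; 1, 0] else 1 := by
  set f : Fin 1 ↪ Fin n := ⟨fun _ => j, fun a b _ => Subsingleton.elim a b⟩
  have hS : applyUnitaryOn f gateS ∈ cliffordGroup n :=
    Subgroup.subset_closure (Or.inl (Or.inl ⟨f, rfl⟩))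
  have hH : applyUnitaryOn f gateH ∈ cliffordGroup n :=
    Subgroup.subset_closure (Or.inl (Or.inr ⟨f, rfl⟩))
  refine ⟨_, mul_mem hH (mul_mem (mul_mem hS hS) hH), ?_⟩
  change applyOn f (oneQubit _) * (applyOn f (oneQubit _) * applyOn f (oneQubit _) *
    applyOn f (oneQubit _)) = _
  simp only [applyOn_oneQubit, tensorMatrix_mul]
  congr 1
  funext i
  by_cases hi : i = j
  · have h : ((√2 : ℝ) : ℂ)⁻¹ * ((√2 : ℝ) : ℂ)⁻¹ = 1 / 2 := by
      rw [← mul_inv, ← Complex.ofReal_mul, Real.mul_self_sqrt (by norm_num)]; norm_num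
    have hi' : i = f 0 := hi
    simp only [if_pos hi, if_pos hi']
    ext a b
    fin_cases a <;> fin_cases b <;> simp [Matrix.mul_apply, h] <;> norm_num
  · have hi' : ¬ i = f 0 := hi
    simp [if_neg hi, if_neg hi']

theorem basisKet_mem_stabilizerStates {n : ℕ} (x : Fin n → Fin 2) :
    basisKet x ∈ stabilizerStates n := by
  classical
  have h : ∀ S : Finset (Fin n), basisKet (fun i => if i ∈ S then 1 else 0) ∈ stabilizerStates n := by
    intro S
    induction S using Finset.induction_on with
    | empty =>
      refine ⟨1, one_mem _, ?_⟩
      rw [QubitUnitary.act, Matrix.UnitaryGroup.one_val, Matrix.one_mulVec]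
      simp only [Finset.notMem_empty, if_false]
      rfl
    | insert j S hj ih =>
      obtain ⟨C, hC, hCj⟩ := exists_cliffordGroup_flip j
      have hact := act_mem_stabilizerStates hC ih
      rw [act_eq_toEuclideanLin, hCj] at hact
      refine Set.mem_of_eq_of_mem ?_ hact
      refine (toEuclideanLin_tensorMatrix_basisKet fun i => ?_).symm
      by_cases hi : i = j
      · subst hi
        ext a
        fin_cases a <;> simp [hj]
      · simp only [if_false, Matrix.one_mulVec, Finset.mem_insert, hi, false_or]
  have hx : (fun i => if i ∈ ({i | x i = 1} : Finset (Fin n)) then 1 else 0) = x := by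
    have : ∀ a : Fin 2, (if a = 1 then 1 else 0) = a := by decide
    funext i
    simpa using this (x i)
  exact hx ▸ h {i | x i = 1}

/-- The infimum of an empty set of naturals would be `0`; expansion in the computational basis shows
that the set is nonempty, so the infimum is attained. -/
theorem exists_stabilizer_decomposition {n : ℕ} (ψ : QubitSpace n) :
    ∃ (α : Fin (stabilizerRank ψ) → ℂ) (s : Fin (stabilizerRank ψ) → QubitSpace n),
      (∀ i, s i ∈ stabilizerStates n) ∧ ψ = ∑ i, α i • s i := by
  refine Nat.sInf_mem (s := {k : ℕ | ∃ (α : Fin k → ℂ) (s : Fin k → QubitSpace n),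
    (∀ i, s i ∈ stabilizerStates n) ∧ ψ = ∑ i, α i • s i}) ?_
  let e := Fintype.equivFin (Fin n → Fin 2)
  refine ⟨Fintype.card (Fin n → Fin 2), fun i => ψ (e.symm i), fun i => basisKet (e.symm i),
    fun i => basisKet_mem_stabilizerStates _, ?_⟩
  rw [e.symm.sum_comp fun x => ψ x • basisKet x]
  ext y
  simp [basisKet, Pi.single_apply]

/-! ### The fidelity bound and the conclusion. -/

theorem fidelity_le_of_stabilizerRank {n : ℕ} {ψ : QubitSpace n} (hψ : ‖ψ‖ = 1) :
    0 < stabilizerRank ψ ∧ fidelity ψ (tensorPower ketH n) ≤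
      2 * stabilizerRank ψ * (4 * (stabilizerRank ψ : ℝ) ^ 2) ^ stabilizerRank ψ *
        (Real.cos (Real.pi / 8) ^ 2) ^ n := by
  obtain ⟨α, s, hs, hsum⟩ := exists_stabilizer_decomposition ψ
  generalize stabilizerRank ψ = k at *
  have hk : 0 < k := by
    rcases Nat.eq_zero_or_pos k with rfl | hk
    · rw [hsum] at hψ
      simp at hψ
    · exact hk
  refine ⟨hk, ?_⟩
  have h := norm_inner_sum_sq_le hk Finset.univ (by simp) (fun i => α i • s i) (fun _ => 1)
    (fun _ _ => le_rfl) fun i _ => by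
      rw [one_mul]
      exact_mod_cast (two_pow_le_card_eigenLabels_of_mem_stabilizerStates (hs i)).trans
        (card_eigenLabels_le_smul (α i) (s i))
  rw [← hsum, hψ] at h
  simpa [fidelity] using h

theorem corollary3 (c : ℝ) (hc : Real.cos (Real.pi / 8) ^ 2 < c) :
    ∃ K : ℝ, 0 < K ∧
      ∀ n : ℕ, 2 ≤ n → ∀ ψ : QubitSpace n, ‖ψ‖ = 1 →
        c ^ n ≤ fidelity ψ (tensorPower ketH n) →
          K * ((n : ℝ) / Real.log n) ≤ (stabilizerRank ψ : ℝ) := by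
  have hρ : 0 < Real.cos (Real.pi / 8) ^ 2 := by
    have : 0 < Real.cos (Real.pi / 8) :=
      Real.cos_pos_of_mem_Ioo ⟨by linarith [Real.pi_pos], by linarith [Real.pi_pos]⟩
    positivity
  set ρ := Real.cos (Real.pi / 8) ^ 2
  have hL : 0 < Real.log (c / ρ) := Real.log_pos ((one_lt_div hρ).mpr hc)
  set L := Real.log (c / ρ) with hLdef
  -- `log 2` serves the case `n ≤ k`, where `log n ≥ log 2`. When `k < n`, `2k ≤ n²` bounds the
  -- logarithm by `2 log n + 4k log n ≤ 6k log n`, whence `L / 6`.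
  refine ⟨min (Real.log 2) (L / 6), lt_min (Real.log_pos (by norm_num)) (by positivity),
    fun n hn ψ hψ hF => ?_⟩
  obtain ⟨hk, hle⟩ := fidelity_le_of_stabilizerRank hψ
  generalize stabilizerRank ψ = k at *
  have hn' : (2 : ℝ) ≤ n := by exact_mod_cast hn
  have hk' : (1 : ℝ) ≤ k := by exact_mod_cast hk
  have hlog2 : 0 < Real.log 2 := Real.log_pos (by norm_num)
  have hlogn : Real.log 2 ≤ Real.log n := Real.log_le_log (by norm_num) hn'
  have hlogn0 : 0 < Real.log n := hlog2.trans_le hlogn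
  rw [← mul_div_assoc, div_le_iff₀ hlogn0]
  rcases le_or_gt n k with hnk | hnk
  · have hnk' : (n : ℝ) ≤ k := by exact_mod_cast hnk
    calc min (Real.log 2) (L / 6) * n ≤ Real.log 2 * n := by gcongr; exact min_le_left _ _
      _ ≤ Real.log n * k := by gcongr
      _ = _ := mul_comm _ _
  · have hnk' : (k : ℝ) ≤ n := by exact_mod_cast hnk.le
    have h1 : (c / ρ) ^ n ≤ 2 * k * (4 * (k : ℝ) ^ 2) ^ k := by
      rw [div_pow, div_le_iff₀ (by positivity)]
      exact hF.trans hle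
    have h2 := Real.log_le_log (by have := div_pos (hρ.trans hc) hρ; positivity) h1
    rw [Real.log_pow, Real.log_mul (by positivity) (by positivity), Real.log_pow,
      show 4 * (k : ℝ) ^ 2 = (2 * k) ^ 2 by ring, Real.log_pow] at h2
    have h3 : Real.log (2 * k) ≤ 2 * Real.log n := by
      calc Real.log (2 * k) ≤ Real.log ((n : ℝ) ^ 2) :=
            Real.log_le_log (by positivity) (by nlinarith)
        _ = _ := by rw [Real.log_pow]; norm_num
    have h4 : n * L ≤ 6 * (k * Real.log n) := by
      push_cast at h2
      calc n * L ≤ Real.log (2 * k) + k * (2 * Real.log (2 * k)) := h2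
        _ ≤ 2 * Real.log n + k * (2 * (2 * Real.log n)) := by gcongr
        _ ≤ 6 * (k * Real.log n) := by nlinarith
    calc min (Real.log 2) (L / 6) * n ≤ L / 6 * n := by gcongr; exact min_le_right _ _
      _ ≤ _ := by linarith
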